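/- Let $p>3$ be a prime and let $X$ be a connected finite simple graph of order $6p$. A permutation group is called imprimitive if it is transitive and preserves a partition of the underlying set other than the partition into singletons and the partition with one part; $X$ is called genuinely imprimitive if some transitive subgroup of $\operatorname{Aut} X$ has a normal subgroup whose orbits form a partition of $V(X)$ different from these two trivial ones. Suppose that $X$ is genuinely imprimitive, let $G\le\operatorname{Aut} X$ be an imprimitive subgroup, let $N\trianglelefteq G$ be a minimal normal subgroup of $G$ (a nontrivial normal subgroup containing no smaller nontrivial normal subgroup of $G$) that is not transitive on $V(X)$, and let $\mathcal B$ be the set of orbits of $N$ on $V(X)$. If every block in $\mathcal B$ has size $6$, then $X$ has a Hamilton cycle. -/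

import Mathlib

/-- A permutation group is imprimitive if it is transitive and admits an invariant partition
other than the two trivial ones, i.e. it has a nontrivial block. -/
def IsImprimitiveAction (G V : Type*) [Group G] [MulAction G V] : Prop :=
  MulAction.IsPretransitive G V ∧ ¬ MulAction.IsPreprimitive G V

/-- A minimal normal subgroup: a nontrivial normal subgroup that contains no other
nontrivial normal subgroup. -/
def IsMinimalNormal {G : Type*} [Group G] (N : Subgroup G) : Prop :=
  N.Normal ∧ N ≠ ⊥ ∧ ∀ M : Subgroup G, M.Normal → M ≤ N → M ≠ ⊥ → M = N

/-- A graph is genuinely imprimitive if some transitive group `G` of automorphisms has a normal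
subgroup `N` whose orbits form a nontrivial partition of the vertex set (neither the partition
into a single part nor the partition into singletons). -/
def SimpleGraph.IsGenuinelyImprimitive {V : Type*} (X : SimpleGraph V) : Prop :=
  ∃ G : Subgroup (X ≃g X), MulAction.IsPretransitive G V ∧
    ∃ N : Subgroup G, N.Normal ∧ ¬ MulAction.IsPretransitive N V ∧
      ∃ v : V, MulAction.orbit N v ≠ {v}

/-! Orbits of size 6 force 6 to divide |N|, so the minimal normal subgroup N is not abelian and
hence is perfect. A perfect group transitive on six points contains a 5-cycle
(`Group.IsPerfect.five_dvd_card_or_subsingleton`), so N is doubly transitive on each orbit. Counting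
common neighbours then gives valency 0, 1, 5 or 6 between two orbits: a matching or the complement
of one (`matching_or_compl_matching`).

G permutes the p orbits transitively and p is prime, so for any two orbits some ρ in G permutes all
p orbits in one cycle and takes the first orbit to the second. If some pair is joined densely, its
ρ-translates carry six parallel strands, and the freedom in the last block lets them close into a
single cycle. Otherwise all pairs are matchings; connectedness then makes every orbit a clique and
gives a perfect matching between some two orbits, and the cycle crosses the cliques one after
another. -/

namespace SimpleGraph

open Finset

variable {V : Type*} [DecidableEq V] {X : SimpleGraph V}

/-! ### Counting between two blocks -/

/-- In a bipartite graph between two sets of six points that is biregular and such that the number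
of common neighbours of a fixed point `x` with any other point is constant, the valency `d`
satisfies `5 ∣ d * (d - 1)`. -/
theorem valency_eq_and_dvd [DecidableRel X.Adj] (S T : Finset V) (hS : S.card = 6) (hT : T.card = 6)
    (d d' l : ℕ) (hd : ∀ a ∈ S, #{b ∈ T | X.Adj a b} = d) (hd' : ∀ b ∈ T, #{a ∈ S | X.Adj a b} = d')
    (x : V) (hx : x ∈ S) (hl : ∀ y ∈ S, y ≠ x → #{b ∈ T | X.Adj x b ∧ X.Adj y b} = l) :
    d = d' ∧ 5 ∣ d * (d - 1) := by
  have h1 : S.card * d = T.card * d' := card_mul_eq_card_mul X.Adj hd hd'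
  have h2 : d = d' := by
    rw [hS, hT] at h1
    omega
  refine ⟨h2, l, ?_⟩
  -- Double count the pairs (y, b) with y ≠ x and b a common neighbour of x and y: 5 * l = d * (d -
  -- 1).
  have h3 := card_mul_eq_card_mul X.Adj (s := S.erase x) (t := {b ∈ T | X.Adj x b}) (m := l)
    (n := d - 1) (by
      intro y hy
      rw [mem_erase] at hy
      rw [bipartiteAbove, filter_filter]
      exact hl y hy.2 hy.1) (by
      intro b hb
      rw [mem_filter] at hb
      rw [bipartiteBelow, filter_erase, card_erase_of_mem (by simp [hx, hb.2]), hd' b hb.1, h2])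
  rw [hd x hx, card_erase_of_mem hx, hS] at h3
  exact h3.symm

/-! ### Hamilton cycles in cyclic arrangements of six-element blocks -/

variable [Fintype V]

/-- A cyclic enumeration of the vertices in which consecutive vertices are adjacent gives a
Hamilton cycle. -/
theorem exists_isHamiltonianCycle_of_enumeration (n : ℕ) (hn : 3 ≤ n)
    (hcard : Fintype.card V = n) (f : ℕ → V)
    (hinj : ∀ k < n, ∀ l < n, f k = f l → k = l)
    (hadj : ∀ k, k + 1 < n → X.Adj (f k) (f (k + 1))) (hlast : X.Adj (f (n - 1)) (f 0)) :
    ∃ (a : V) (c : X.Walk a a), c.IsHamiltonianCycle := by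
  obtain ⟨m, rfl⟩ := Nat.exists_eq_add_of_le' hn
  have hstep : ∀ v : Fin (m + 3), X.Adj (f v) (f (v + 1 : Fin (m + 3))) := by
    intro v
    by_cases hv : v = Fin.last (m + 2)
    · subst hv
      simpa using hlast
    · rw [Fin.val_add_one_of_lt (Fin.lt_last_iff_ne_last.2 hv)]
      refine hadj _ ?_
      have := Fin.lt_last_iff_ne_last.2 hv
      rw [Fin.lt_def, Fin.val_last] at this
      omega
  let φ : cycleGraph (m + 3) →g X :=
    { toFun := fun v => f v
      map_rel' := by
        intro u v h
        rcases cycleGraph_adj.1 h with h | h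
        · rw [sub_eq_iff_eq_add'] at h
          subst h
          exact (hstep v).symm
        · rw [sub_eq_iff_eq_add'] at h
          subst h
          exact hstep u }
  have hbij : Function.Bijective φ := by
    rw [Fintype.bijective_iff_injective_and_card]
    exact ⟨fun u v h => Fin.ext (hinj u u.2 v v.2 h), by simp [hcard]⟩
  refine ⟨_, (cycleGraph.cycle m).map φ, Walk.IsHamiltonianCycle.map hbij ?_⟩
  rw [Walk.isHamiltonianCycle_iff_isCycle_and_length_eq]
  exact ⟨cycleGraph.isCycle_cycle, by simp⟩

/-- A two-parameter version of `exists_isHamiltonianCycle_of_enumeration`, in which the second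
index runs faster. -/
theorem exists_isHamiltonianCycle_of_grid (a b : ℕ) (hab : 3 ≤ a * b)
    (hcard : Fintype.card V = a * b) (g : ℕ → ℕ → V)
    (hinj : ∀ i < a, ∀ j < b, ∀ i' < a, ∀ j' < b, g i j = g i' j' → i = i' ∧ j = j')
    (hadj : ∀ i < a, ∀ j, j + 1 < b → X.Adj (g i j) (g i (j + 1)))
    (hnext : ∀ i, i + 1 < a → X.Adj (g i (b - 1)) (g (i + 1) 0))
    (hlast : X.Adj (g (a - 1) (b - 1)) (g 0 0)) :
    ∃ (a : V) (c : X.Walk a a), c.IsHamiltonianCycle := by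
  have hb : 0 < b := Nat.pos_of_ne_zero (by rintro rfl; simp at hab)
  have ha : 0 < a := Nat.pos_of_ne_zero (by rintro rfl; simp at hab)
  have hdiv : ∀ k < a * b, k / b < a := fun k hk => Nat.div_lt_of_lt_mul (by rwa [mul_comm])
  refine exists_isHamiltonianCycle_of_enumeration (a * b) hab hcard
    (fun k => g (k / b) (k % b)) ?_ ?_ ?_
  · intro k hk l hl h
    obtain ⟨h1, h2⟩ := hinj _ (hdiv k hk) _ (Nat.mod_lt _ hb) _ (hdiv l hl) _ (Nat.mod_lt _ hb) h
    rw [← Nat.div_add_mod k b, ← Nat.div_add_mod l b, h1, h2]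
  · intro k hk
    have hk' := Nat.div_add_mod k b
    have hlt := Nat.mod_lt k hb
    by_cases h : k % b + 1 < b
    · have h1 : (k + 1) / b = k / b := by
        rw [Nat.div_eq_iff hb, mul_comm]
        omega
      have h2 : (k + 1) % b = k % b + 1 := by
        rw [Nat.add_mod, Nat.mod_eq_of_lt (a := 1) (by omega), Nat.mod_eq_of_lt h]
      simp only [h1, h2]
      exact hadj _ (hdiv k (by omega)) _ h
    · have h0 : k % b = b - 1 := by omega
      have h3 : k + 1 = b * (k / b + 1) := by
        rw [Nat.mul_add]
        omega
      have h1 : (k + 1) / b = k / b + 1 := by rw [h3, Nat.mul_div_cancel_left _ hb]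
      have h2 : (k + 1) % b = 0 := by rw [h3, Nat.mul_mod_right]
      simp only [h1, h2, h0]
      refine hnext _ ?_
      rw [← h1]
      exact hdiv _ hk
  · have h3 : a * b - 1 = b * (a - 1) + (b - 1) := by
      obtain ⟨a, rfl⟩ := Nat.exists_eq_add_of_le' ha
      obtain ⟨b, rfl⟩ := Nat.exists_eq_add_of_le' hb
      simp only [Nat.add_sub_cancel]
      rw [show (a + 1) * (b + 1) = (b + 1) * a + b + 1 by ring]
      simp
    have h1 : (a * b - 1) / b = a - 1 := by
      rw [h3, Nat.mul_add_div hb, Nat.div_eq_of_lt (by omega), add_zero]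
    have h2 : (a * b - 1) % b = b - 1 := by
      rw [h3, Nat.mul_add_mod, Nat.mod_eq_of_lt (by omega)]
    simpa only [h1, h2, Nat.zero_div, Nat.zero_mod] using hlast

/-- Given two bipartite graphs on six plus six points, each missing at most a matching, and a
permutation `c`, one can choose a bijective midpoint from `j` to `c j` along edges. -/
theorem exists_perm_midpoint (R S : Fin 6 → Fin 6 → Prop)
    (hR : ∀ j k k', ¬ R j k → ¬ R j k' → k = k') (hR' : ∀ j j' k, ¬ R j k → ¬ R j' k → j = j')
    (hS : ∀ j k k', ¬ S j k → ¬ S j k' → k = k') (hS' : ∀ j j' k, ¬ S j k → ¬ S j' k → j = j')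
    (c : Equiv.Perm (Fin 6)) :
    ∃ τ : Equiv.Perm (Fin 6), ∀ j, R j (τ j) ∧ S (τ j) (c j) := by
  classical
  let t : Fin 6 → Finset (Fin 6) := fun j => univ.filter fun k => R j k ∧ S k (c j)
  obtain ⟨f, hf, hft⟩ := (Finset.all_card_le_biUnion_card_iff_exists_injective t).1 (by
    intro s
    -- Hall's condition: each `t j` omits at most two midpoints, so has at least four. A midpoint is
    -- excluded for at most two indices, so five indices together reach all six.
    by_cases hs : s.card ≤ 4
    · rcases s.eq_empty_or_nonempty with rfl | ⟨j, hj⟩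
      · simp
      refine hs.trans (le_trans ?_ (card_le_card (subset_biUnion_of_mem t hj)))
      have h1 : (univ.filter fun k => ¬ R j k).card ≤ 1 :=
        card_le_one.2 fun x hx y hy => hR j x y (by simpa using hx) (by simpa using hy)
      have h2 : (univ.filter fun k => ¬ S k (c j)).card ≤ 1 :=
        card_le_one.2 fun x hx y hy => hS' x y (c j) (by simpa using hx) (by simpa using hy)
      have h3 : (univ : Finset (Fin 6)) ⊆
          t j ∪ ((univ.filter fun k => ¬ R j k) ∪ univ.filter fun k => ¬ S k (c j)) := by
        intro k _
        simp only [t, mem_union, mem_filter, mem_univ, true_and]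
        tauto
      have h4 := card_le_card h3
      have h5 := card_union_le (t j)
        ((univ.filter fun k => ¬ R j k) ∪ univ.filter fun k => ¬ S k (c j))
      have h6 := card_union_le (univ.filter fun k => ¬ R j k) (univ.filter fun k => ¬ S k (c j))
      simp only [card_univ, Fintype.card_fin] at h4
      omega
    · have : s.biUnion t = univ := by
        refine eq_univ_iff_forall.2 fun k => ?_
        by_contra hk
        simp only [t, mem_biUnion, mem_filter, mem_univ, true_and, not_exists, not_and] at hk
        have h1 : (univ.filter fun j => ¬ R j k).card ≤ 1 :=
          card_le_one.2 fun x hx y hy => hR' x y k (by simpa using hx) (by simpa using hy)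
        have h2 : (univ.filter fun j => ¬ S k (c j)).card ≤ 1 :=
          card_le_one.2 fun x hx y hy =>
            c.injective (hS k (c x) (c y) (by simpa using hx) (by simpa using hy))
        have h3 : s ⊆ (univ.filter fun j => ¬ R j k) ∪ univ.filter fun j => ¬ S k (c j) := by
          intro j hj
          have := hk j hj
          simp only [mem_union, mem_filter, mem_univ, true_and]
          tauto
        have h4 := card_le_card h3
        have h6 := card_union_le (univ.filter fun j => ¬ R j k) (univ.filter fun j => ¬ S k (c j))
        omega
      rw [this]
      exact card_le_univ s)
  refine ⟨Equiv.ofBijective f (Finite.injective_iff_bijective.1 hf), fun j => ?_⟩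
  simpa [t] using hft j

/-- A cyclic arrangement of blocks of size six in which consecutive blocks are joined by a
complete bipartite graph minus at most a matching has a Hamilton cycle. -/
theorem exists_isHamiltonianCycle_of_dense_blocks (p : ℕ) (hp : 3 ≤ p)
    (hcard : Fintype.card V = 6 * p) (B : ℕ → Fin 6 → V)
    (hinj : ∀ i < p, ∀ i' < p, ∀ j j', B i j = B i' j' → i = i' ∧ j = j')
    (hadj : ∀ i, i + 2 < p → ∀ j, X.Adj (B i j) (B (i + 1) j))
    (hR : ∀ j k k', ¬ X.Adj (B (p - 2) j) (B (p - 1) k) →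
      ¬ X.Adj (B (p - 2) j) (B (p - 1) k') → k = k')
    (hR' : ∀ j j' k, ¬ X.Adj (B (p - 2) j) (B (p - 1) k) →
      ¬ X.Adj (B (p - 2) j') (B (p - 1) k) → j = j')
    (hS : ∀ j k k', ¬ X.Adj (B (p - 1) j) (B 0 k) → ¬ X.Adj (B (p - 1) j) (B 0 k') → k = k')
    (hS' : ∀ j j' k, ¬ X.Adj (B (p - 1) j) (B 0 k) → ¬ X.Adj (B (p - 1) j') (B 0 k) → j = j') :
    ∃ (a : V) (c : X.Walk a a), c.IsHamiltonianCycle := by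
  -- Relabelling block p - 1 by `τ` makes strand j continue into strand j + 1, so the six strands
  -- form one cycle.
  obtain ⟨τ, hτ⟩ := exists_perm_midpoint (fun j k => X.Adj (B (p - 2) j) (B (p - 1) k))
    (fun j k => X.Adj (B (p - 1) j) (B 0 k)) hR hR' hS hS' (finRotate 6)
  refine exists_isHamiltonianCycle_of_grid 6 p (by omega) hcard
    (fun j i => if i = p - 1 then B i (τ (Fin.ofNat 6 j)) else B i (Fin.ofNat 6 j)) ?_ ?_ ?_ ?_
  · intro j hj i hi j' hj' i' hi' h
    have hii : i = i' := by
      split_ifs at h <;> exact (hinj _ hi _ hi' _ _ h).1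
    subst hii
    have hjj : Fin.ofNat 6 j = Fin.ofNat 6 j' := by
      split_ifs at h
      · exact τ.injective (hinj _ hi _ hi' _ _ h).2
      · exact (hinj _ hi _ hi' _ _ h).2
    have := congrArg Fin.val hjj
    simp only [Fin.val_ofNat] at this
    omega
  · intro j hj i hi
    have h1 : i ≠ p - 1 := by omega
    by_cases h2 : i + 1 = p - 1
    · simp only [if_neg h1, if_pos h2]
      have := (hτ (Fin.ofNat 6 j)).1
      rwa [← h2, show p - 2 = i by omega] at this
    · simp only [if_neg h1, if_neg h2]
      exact hadj i (by omega) _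
  · intro j hj
    have h2 := (hτ (Fin.ofNat 6 j)).2
    have h1 : (0 : ℕ) ≠ p - 1 := by omega
    simp only [if_neg h1, if_true]
    convert h2 using 2
    have hj5 : j < 5 := by omega
    interval_cases j <;> rfl
  · have h2 := (hτ 5).2
    have h1 : (0 : ℕ) ≠ p - 1 := by omega
    simp only [if_neg h1, if_true]
    exact h2

/-- Such a π orders a complete block into a Hamilton path with prescribed distinct ends. -/
theorem exists_perm_zero_five (x y : Fin 6) (hxy : x ≠ y) :
    ∃ π : Equiv.Perm (Fin 6), π 0 = x ∧ π 5 = y := by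
  refine ⟨Equiv.swap 0 x * Equiv.swap 5 (Equiv.swap 0 x y), ?_, ?_⟩
  · have h : Equiv.swap 0 x y ≠ 0 := fun h => hxy.symm <| by
      rw [Equiv.swap_apply_eq_iff] at h
      simpa using h
    rw [Equiv.Perm.mul_apply, Equiv.swap_apply_of_ne_of_ne (by decide) h.symm,
      Equiv.swap_apply_left]
  · simp

/-- A cyclic arrangement of complete graphs of order six, consecutive ones being joined by a
perfect matching, has a Hamilton cycle. -/
theorem exists_isHamiltonianCycle_of_complete_blocks (p : ℕ) (hp : 3 ≤ p)
    (hcard : Fintype.card V = 6 * p) (B : ℕ → Fin 6 → V)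
    (hinj : ∀ i < p, ∀ i' < p, ∀ j j', B i j = B i' j' → i = i' ∧ j = j')
    (hblock : ∀ i < p, ∀ j j', j ≠ j' → X.Adj (B i j) (B i j'))
    (hadj : ∀ i, i + 1 < p → ∀ j, X.Adj (B i j) (B (i + 1) j))
    (s : Equiv.Perm (Fin 6)) (hs : ∀ j, X.Adj (B (p - 1) j) (B 0 (s j))) :
    ∃ (a : V) (c : X.Walk a a), c.IsHamiltonianCycle := by
  -- `c` is the exit label of the last block: it must differ from the entry label there, (p - 2) %
  -- 2, and `s c`, the entry label of block 0, must differ from the exit label 0.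
  obtain ⟨c, hc⟩ : ∃ c : Fin 6, c ∉ ({Fin.ofNat 6 ((p - 2) % 2), s.symm 0} : Finset (Fin 6)) := by
    by_contra! h
    have h1 := card_le_card (fun x _ => h x : (univ : Finset (Fin 6)) ⊆ _)
    have h2 := card_le_two (a := Fin.ofNat 6 ((p - 2) % 2)) (b := s.symm 0)
    simp only [card_univ, Fintype.card_fin] at h1
    omega
  simp only [mem_insert, mem_singleton, not_or] at hc
  have hpar : ∀ i, Fin.ofNat 6 (i % 2) ≠ Fin.ofNat 6 ((i + 1) % 2) := by
    intro i h
    have := congrArg Fin.val h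
    simp only [Fin.val_ofNat] at this
    omega
  -- `v i` and `u i` are the exit and entry labels of block i; exits alternate between 0 and 1
  -- before the last block.
  let v : ℕ → Fin 6 := fun i => if i = p - 1 then c else Fin.ofNat 6 (i % 2)
  let u : ℕ → Fin 6 := fun i => if i = 0 then s c else v (i - 1)
  have huv : ∀ i < p, u i ≠ v i := by
    intro i hi
    rcases Nat.eq_zero_or_pos i with rfl | hi0
    · simp only [u, v, if_true, if_neg (show (0 : ℕ) ≠ p - 1 by omega)]
      intro h
      exact hc.2 (by rw [Equiv.eq_symm_apply, h]; rfl)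
    · obtain ⟨k, rfl⟩ := Nat.exists_eq_add_of_le' hi0
      simp only [u, v, if_neg (Nat.succ_ne_zero k), Nat.add_sub_cancel,
        if_neg (show k ≠ p - 1 by omega)]
      split_ifs with h
      · rw [show k = p - 2 by omega]
        exact fun h => hc.1 h.symm
      · exact hpar k
  have hπ : ∀ i, ∃ π : Equiv.Perm (Fin 6), i < p → π 0 = u i ∧ π 5 = v i := by
    intro i
    by_cases hi : i < p
    · obtain ⟨π, hπ⟩ := exists_perm_zero_five _ _ (huv i hi)
      exact ⟨π, fun _ => hπ⟩
    · exact ⟨1, fun h => absurd h hi⟩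
  choose π hπ using hπ
  refine exists_isHamiltonianCycle_of_grid p 6 (by omega) (by rw [hcard, mul_comm])
    (fun i j => B i (π i (Fin.ofNat 6 j))) ?_ ?_ ?_ ?_
  · intro i hi j hj i' hi' j' hj' h
    obtain ⟨rfl, h2⟩ := hinj _ hi _ hi' _ _ h
    have := congrArg Fin.val ((π i).injective h2)
    simp only [Fin.val_ofNat] at this
    exact ⟨rfl, by omega⟩
  · intro i hi j hj
    refine hblock i hi _ _ fun h => ?_
    have := congrArg Fin.val ((π i).injective h)
    simp only [Fin.val_ofNat] at this
    omega
  · intro i hi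
    have h1 : π i (Fin.ofNat 6 (6 - 1)) = v i := (hπ i (by omega)).2
    have h2 : π (i + 1) (Fin.ofNat 6 0) = v i := by
      refine (hπ (i + 1) hi).1.trans ?_
      simp [u]
    simp only [h1, h2]
    exact hadj i hi _
  · have h1 : π (p - 1) (Fin.ofNat 6 (6 - 1)) = c :=
      (hπ (p - 1) (by omega)).2.trans (by simp [v])
    have h2 : π 0 (Fin.ofNat 6 0) = s c := (hπ 0 (by omega)).1.trans (by simp [u])
    simp only [h1, h2]
    exact hs c

end SimpleGraph

/-! ### Perfect permutation groups of degree six -/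

theorem Equiv.Perm.isSolvable_of_card_eq_four {α : Type*} [Finite α] (h : Nat.card α = 4) :
    Group.IsSolvable (Equiv.Perm α) := by
  classical
  have := Fintype.ofFinite α
  have hA : Group.IsSolvable (alternatingGroup α) := by
    have hk := alternatingGroup.kleinFour_isKleinFour h
    rw [alternatingGroup.kleinFour_eq_commutator h] at hk
    have hc : IsMulCommutative (commutator (alternatingGroup α)) := IsKleinFour.isMulCommutative
    have : Group.IsSolvable (commutator (alternatingGroup α)) :=
      Group.isSolvable_of_comm fun a b => hc.is_comm.comm a b
    have h2 : Group.IsSolvable (alternatingGroup α ⧸ commutator (alternatingGroup α)) :=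
      inferInstanceAs (Group.IsSolvable (Abelianization (alternatingGroup α)))
    exact (Group.isSolvable_iff_subgroup_quotient (commutator (alternatingGroup α))).2 ⟨this, h2⟩
  refine Group.isSolvable_of_ker_le_range (alternatingGroup α).subtype Equiv.Perm.sign ?_
  rw [Subgroup.range_subtype]
  exact le_of_eq rfl

/-- A homomorphism from a perfect group to a solvable group is trivial. -/
theorem Group.IsPerfect.apply_eq_one {H Q : Type*} [Group H] [Group Q] [Group.IsPerfect H]
    [Group.IsSolvable Q] (f : H →* Q) (x : H) : f x = 1 := by
  have := Group.IsPerfect.range f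
  by_contra hx
  have : Nontrivial f.range :=
    ⟨⟨⟨f x, x, rfl⟩, 1, fun h => hx (congrArg Subtype.val h)⟩⟩
  exact Group.IsPerfect.not_isSolvable f.range inferInstance

/-- A perfect group whose order divides `72` is trivial. -/
theorem Group.IsPerfect.subsingleton_of_card_dvd {H : Type*} [Group H] [Finite H]
    [Group.IsPerfect H] (h : Nat.card H ∣ 72) : Subsingleton H := by
  have : Fact (Nat.Prime 3) := ⟨Nat.prime_three⟩
  have : Fact (Nat.Prime 2) := ⟨Nat.prime_two⟩
  let P : Sylow 3 H := default
  have h1 : Nat.card (Sylow 3 H) ≡ 1 [MOD 3] := card_sylow_modEq_one 3 H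
  have h3 : (P : Subgroup H).index ∣ 8 := by
    have ha : (P : Subgroup H).index ∣ 8 * 9 := (P : Subgroup H).index_dvd_card.trans h
    have hb : Nat.Coprime (P : Subgroup H).index 9 :=
      Nat.Coprime.pow_right 2 ((Nat.Prime.coprime_iff_not_dvd Nat.prime_three).2 P.not_dvd_index).symm
    exact hb.dvd_of_dvd_mul_right ha
  have h2 : Nat.card (Sylow 3 H) ∣ 8 := P.card_dvd_index.trans h3
  have hsub : Subsingleton (Sylow 3 H) := by
    have h4 : Nat.card (Sylow 3 H) ≤ 8 := Nat.le_of_dvd (by norm_num) h2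
    have h5 : Nat.card (Sylow 3 H) = 1 ∨ Nat.card (Sylow 3 H) = 4 := by
      -- Only 1 and 4 are both divisors of 8 and 1 mod 3. With four Sylow subgroups, H would act
      -- trivially on them, S₄ being solvable, yet transitively.
      generalize Nat.card (Sylow 3 H) = n at *
      interval_cases n <;> revert h1 h2 <;> decide
    rcases h5 with h5 | h5
    · exact (Nat.card_eq_one_iff_unique.1 h5).1
    · have := Equiv.Perm.isSolvable_of_card_eq_four h5
      refine ⟨fun Q R => ?_⟩
      obtain ⟨g, hg⟩ := MulAction.exists_smul_eq H Q R
      have := Group.IsPerfect.apply_eq_one (MulAction.toPermHom H (Sylow 3 H)) g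
      rw [← hg]
      exact (congrArg (fun σ : Equiv.Perm (Sylow 3 H) => σ Q) this).symm
  have hn := P.normal_of_subsingleton
  have hq : IsPGroup 2 (H ⧸ (P : Subgroup H)) := by
    rw [IsPGroup.iff_card]
    obtain ⟨k, -, hk⟩ := (Nat.dvd_prime_pow Nat.prime_two (m := 3)).1 h3
    exact ⟨k, hk⟩
  have hqs : Group.IsSolvable (H ⧸ (P : Subgroup H)) := by
    have := hq.isNilpotent
    infer_instance
  have hPs : Group.IsSolvable (P : Subgroup H) := by
    have := P.isPGroup'.isNilpotent
    infer_instance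
  have : Group.IsSolvable H := (Group.isSolvable_iff_subgroup_quotient (P : Subgroup H)).2 ⟨hPs, hqs⟩
  by_contra hns
  rw [not_subsingleton_iff_nontrivial] at hns
  exact Group.IsPerfect.not_isSolvable H this

/-- A perfect group of permutations of six points is trivial or of order divisible by five. -/
theorem Group.IsPerfect.five_dvd_card_or_subsingleton {α : Type*} [Finite α] (hα : Nat.card α = 6)
    (H : Subgroup (Equiv.Perm α)) [Group.IsPerfect H] : 5 ∣ Nat.card H ∨ Subsingleton H := by
  classical
  have := Fintype.ofFinite α
  have hα' : Fintype.card α = 6 := by rw [← Nat.card_eq_fintype_card, hα]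
  have : Nontrivial α := by
    rw [← Fintype.one_lt_card_iff_nontrivial]
    omega
  rw [or_iff_not_imp_left]
  intro h5
  have hle : H ≤ alternatingGroup α := fun x hx =>
    Equiv.Perm.mem_alternatingGroup.2
      (Group.IsPerfect.apply_eq_one (Equiv.Perm.sign.comp H.subtype) ⟨x, hx⟩)
  have h1 : Nat.card H ∣ 72 * 5 := by
    refine (Subgroup.card_dvd_of_le hle).trans ?_
    have h2 := two_mul_nat_card_alternatingGroup (α := α)
    rw [Nat.card_eq_fintype_card (α := Equiv.Perm α), Fintype.card_perm, hα'] at h2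
    have h3 : Nat.card (alternatingGroup α) = 72 * 5 := by
      have : Nat.factorial 6 = 2 * (72 * 5) := rfl
      omega
    rw [h3]
  have h2 : Nat.Coprime (Nat.card H) 5 :=
    ((Nat.Prime.coprime_iff_not_dvd Nat.prime_five).2 h5).symm
  exact Group.IsPerfect.subsingleton_of_card_dvd (h2.dvd_of_dvd_mul_right h1)

/-- A perfect group acting transitively on six points acts doubly transitively. -/
theorem Group.IsPerfect.exists_smul_eq_smul_eq {N α : Type*} [Group N] [Group.IsPerfect N]
    [MulAction N α] [MulAction.IsPretransitive N α] [Finite α] (hα : Nat.card α = 6)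
    (x y z : α) (hy : y ≠ x) (hz : z ≠ x) : ∃ n : N, n • x = x ∧ n • y = z := by
  classical
  have := Fintype.ofFinite α
  have hα' : Fintype.card α = 6 := by rw [← Nat.card_eq_fintype_card, hα]
  have hperf := Group.IsPerfect.range (MulAction.toPermHom N α)
  have h5 : 5 ∣ Nat.card (MulAction.toPermHom N α).range := by
    refine (Group.IsPerfect.five_dvd_card_or_subsingleton hα _).resolve_right fun h => hy ?_
    obtain ⟨n, hn⟩ := MulAction.exists_smul_eq N x y
    have h1 : (⟨MulAction.toPermHom N α n, n, rfl⟩ : (MulAction.toPermHom N α).range) = 1 :=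
      Subsingleton.elim _ _
    have h2 := congrArg (fun σ : Equiv.Perm α => σ x) (congrArg Subtype.val h1)
    rw [← hn]
    exact h2
  have : Fact (Nat.Prime 5) := ⟨Nat.prime_five⟩
  obtain ⟨⟨σ, hmem⟩, hσ⟩ := exists_prime_orderOf_dvd_card' 5 h5
  rw [Subgroup.orderOf_mk] at hσ
  obtain ⟨n, hσn⟩ := hmem
  -- Since 6 < 2 * 5, an element of order 5 is a single 5-cycle, with one fixed point w; conjugation
  -- by `m` moves this point to x.
  have hcyc : σ.IsCycle := Equiv.Perm.isCycle_of_prime_order' (by rw [hσ]; exact Nat.prime_five)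
    (by rw [hσ, hα']; norm_num)
  have hsupp : σ.support.card = 5 := by rw [← hcyc.orderOf, hσ]
  have hcompl : σ.supportᶜ.card = 1 := by rw [Finset.card_compl, hα', hsupp]
  obtain ⟨w, hw⟩ := Finset.card_eq_one.1 hcompl
  have hfix : ∀ u, σ u = u ↔ u = w := fun u => by
    rw [← Finset.mem_singleton (a := w) (b := u), ← hw, Finset.mem_compl, Equiv.Perm.mem_support, not_not]
  obtain ⟨m, hm⟩ := MulAction.exists_smul_eq N x w
  have hmoved : ∀ u, u ≠ x → σ (m • u) ≠ m • u := fun u hu h =>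
    hu (smul_left_cancel m (((hfix _).1 h).trans hm.symm))
  obtain ⟨k, hk⟩ := hcyc.sameCycle (hmoved y hy) (hmoved z hz)
  have hpow : ∀ u, (n ^ k) • u = (σ ^ k) u := fun u => by
    rw [← hσn, ← map_zpow, MulAction.toPermHom_apply, MulAction.toPerm_apply]
  refine ⟨m⁻¹ * n ^ k * m, ?_, ?_⟩
  · rw [mul_smul, mul_smul, hm, hpow, Equiv.Perm.zpow_apply_eq_self_of_apply_eq_self ((hfix w).2 rfl),
      ← hm, inv_smul_smul]
  · rw [mul_smul, mul_smul, hpow, hk, inv_smul_smul]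

/-! ### Minimal normal subgroups and actions of prime degree -/

/-- A finite minimal normal subgroup whose order is divisible by six is perfect. -/
theorem IsMinimalNormal.isPerfect {G : Type*} [Group G] [Finite G] {N : Subgroup G}
    (hN : IsMinimalNormal N) (h6 : 6 ∣ Nat.card N) : Group.IsPerfect N := by
  obtain ⟨hnor, hbot, hmin⟩ := hN
  rw [Subgroup.isPerfect_iff]
  by_contra hne
  have hcomm : ⁅N, N⁆ = ⊥ := by
    by_contra hb
    exact hne (hmin _ inferInstance (Subgroup.commutator_le_left N N) hb)
  have hc : ∀ a ∈ N, ∀ b ∈ N, a * b = b * a := fun a ha b hb =>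
    (Subgroup.mem_centralizer_iff.1 (Subgroup.commutator_eq_bot_iff_le_centralizer.1 hcomm ha) b hb).symm
  -- In the abelian case the elements of order at most 2 form a nontrivial normal subgroup, hence
  -- all of N, against an element of order 3.
  let M : Subgroup G :=
    { carrier := {a | a ∈ N ∧ a * a = 1}
      mul_mem' := fun {a b} ha hb => ⟨N.mul_mem ha.1 hb.1, by
        rw [mul_assoc, ← mul_assoc b a b, hc b hb.1 a ha.1, mul_assoc a b b, hb.2, mul_one, ha.2]⟩
      one_mem' := ⟨N.one_mem, one_mul 1⟩
      inv_mem' := fun {a} ha => ⟨N.inv_mem ha.1, by rw [← mul_inv_rev, ha.2, inv_one]⟩ }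
  have hMn : M.Normal := ⟨fun a ha g => ⟨hnor.conj_mem a ha.1 g, by
    rw [conj_mul, ha.2, mul_one, mul_inv_cancel]⟩⟩
  have : Fact (Nat.Prime 2) := ⟨Nat.prime_two⟩
  have : Fact (Nat.Prime 3) := ⟨Nat.prime_three⟩
  obtain ⟨a, ha⟩ := exists_prime_orderOf_dvd_card' (G := N) 2 (dvd_trans (by norm_num) h6)
  obtain ⟨b, hb⟩ := exists_prime_orderOf_dvd_card' (G := N) 3 (dvd_trans (by norm_num) h6)
  have hM : M = N := by
    refine hmin M hMn (fun x hx => hx.1) fun hM => ?_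
    have h1 : (a : G) ∈ M := ⟨a.2, by
      have := pow_orderOf_eq_one a
      rw [ha, sq] at this
      exact congrArg Subtype.val this⟩
    rw [hM, Subgroup.mem_bot, OneMemClass.coe_eq_one] at h1
    rw [h1, orderOf_one] at ha
    omega
  have h2 : (b : G) ∈ M := by rw [hM]; exact b.2
  have h3 : b ^ 2 = 1 := Subtype.ext (by rw [sq]; exact h2.2)
  have h4 := orderOf_dvd_of_pow_eq_one h3
  rw [hb] at h4
  omega

/-- A finite group acting transitively on a set of prime size `p` contains, for any two distinct
points, an element which maps the first to the second and whose cycle has length `p`. -/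
theorem MulAction.exists_smul_eq_and_pow_smul_eq_iff {G Ω : Type*} [Group G] [MulAction G Ω]
    [Finite Ω] [MulAction.IsPretransitive G Ω] (p : ℕ) (hp : p.Prime) (hΩ : Nat.card Ω = p)
    (x y : Ω) (hxy : x ≠ y) : ∃ g : G, g • x = y ∧ ∀ i : ℕ, g ^ i • x = x ↔ p ∣ i := by
  classical
  have := Fintype.ofFinite Ω
  have hΩ' : Fintype.card Ω = p := by rw [← Nat.card_eq_fintype_card, hΩ]
  have : Fact p.Prime := ⟨hp⟩
  let H := (MulAction.toPermHom G Ω).range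
  have htr : MulAction.IsPretransitive H Ω := ⟨fun x y => by
    obtain ⟨g, hg⟩ := MulAction.exists_smul_eq G x y
    exact ⟨⟨_, g, rfl⟩, hg⟩⟩
  have : Nonempty Ω := (Nat.card_pos_iff.1 (hΩ ▸ hp.pos)).1
  have hdvd : p ∣ Nat.card H := by
    rw [← hΩ, ← MulAction.index_stabilizer_of_transitive H (Classical.arbitrary Ω)]
    exact Subgroup.index_dvd_card _
  obtain ⟨⟨σ, hmem⟩, hσ⟩ := exists_prime_orderOf_dvd_card' p hdvd
  rw [Subgroup.orderOf_mk] at hσ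
  obtain ⟨g, hσg⟩ := hmem
  have hcyc : σ.IsCycle := Equiv.Perm.isCycle_of_prime_order' (by rw [hσ]; exact hp)
    (by rw [hσ, hΩ']; have := hp.pos; omega)
  have hsupp : σ.support = Finset.univ := by
    rw [← Finset.card_eq_iff_eq_univ, ← hcyc.orderOf, hσ, hΩ']
  have hmoved : ∀ u, σ u ≠ u := fun u => by
    rw [← Equiv.Perm.mem_support, hsupp]
    exact Finset.mem_univ u
  have hpow : ∀ (k : ℕ) (u : Ω), (g ^ k) • u = (σ ^ k) u := fun k u => by
    rw [← hσg, ← map_pow, MulAction.toPermHom_apply, MulAction.toPerm_apply]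
  have hper : ∀ k : ℕ, g ^ k • x = x ↔ p ∣ k := fun k => by
    rw [hpow, ← hcyc.pow_eq_one_iff' (hmoved x), ← hσ, orderOf_dvd_iff_pow_eq_one]
  obtain ⟨k, hk⟩ := (hcyc.sameCycle (hmoved x) (hmoved y)).exists_nat_pow_eq
  rw [← hpow] at hk
  -- As y ≠ x, the exponent k is prime to p, so `g ^ k` still has period p at x.
  refine ⟨g ^ k, hk, fun i => ?_⟩
  have hpk : ¬ p ∣ k := fun h => hxy (((hper k).2 h).symm.trans hk)
  rw [← pow_mul, hper, hp.dvd_mul]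
  tauto

/-! ### Orbits as blocks of the graph -/

namespace SimpleGraph

open scoped Pointwise

variable {V : Type*} {X : SimpleGraph V} {G : Type*} [Group G] [MulAction G V]

/-- A set of six vertices together with a symmetry `ρ` such that `O` is joined to `ρ • O` by a
perfect matching: the translates of `O` can be labelled consistently with this matching. -/
theorem exists_labelling_of_perm (hX : ∀ (g : G) (u v : V), X.Adj (g • u) (g • v) ↔ X.Adj u v)
    (O : Set V) (ρ : G) (b : Fin 6 ≃ O) (τ : Equiv.Perm (Fin 6))
    (hτ : ∀ j, X.Adj (b j : V) (ρ • (b (τ j) : V))) :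
    ∃ B : ℕ → Fin 6 → V, (∀ i j, B i j ∈ ρ ^ i • O) ∧ (∀ i, Function.Injective (B i)) ∧
      (∀ i, ∀ v ∈ ρ ^ i • O, ∃ j, B i j = v) ∧ ∀ i j, X.Adj (B i j) (B (i + 1) j) := by
  -- The twist by `τ ^ i` makes the translated matchings preserve labels.
  refine ⟨fun i j => ρ ^ i • (b ((τ ^ i) j) : V), fun i j => Set.smul_mem_smul_set (b _).2,
    fun i j j' h => (τ ^ i).injective (b.injective (Subtype.ext (smul_left_cancel _ h))), ?_, ?_⟩
  · rintro i _ ⟨u, hu, rfl⟩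
    exact ⟨(τ ^ i).symm (b.symm ⟨u, hu⟩), by simp⟩
  · intro i j
    dsimp only
    rw [pow_succ ρ, mul_smul, hX, pow_succ' τ]
    exact hτ _

/-- The action of an automorphism that permutes six-element blocks cyclically makes the labelled
blocks disjoint. -/
theorem labelling_injective {O : Set V} {ρ : G} {p : ℕ} (hper : ∀ i : ℕ, ρ ^ i • O = O ↔ p ∣ i)
    (hO : ∀ i i' : ℕ, ∀ v, v ∈ ρ ^ i • O → v ∈ ρ ^ i' • O → ρ ^ i • O = ρ ^ i' • O)
    {B : ℕ → Fin 6 → V} (hB : ∀ i j, B i j ∈ ρ ^ i • O) (hinj : ∀ i, Function.Injective (B i)) :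
    ∀ i < p, ∀ i' < p, ∀ j j', B i j = B i' j' → i = i' ∧ j = j' := by
  have key : ∀ i i' : ℕ, i ≤ i' → i' < p → ∀ v, v ∈ ρ ^ i • O → v ∈ ρ ^ i' • O → i = i' := by
    intro i i' hii hi' v h1 h2
    have h3 := hO i i' v h1 h2
    obtain ⟨k, rfl⟩ := Nat.exists_eq_add_of_le hii
    rw [pow_add, mul_smul, smul_left_cancel_iff, eq_comm, hper] at h3
    rcases Nat.eq_zero_or_pos k with rfl | hk
    · rfl
    · have := Nat.le_of_dvd hk h3
      omega
  intro i hi i' hi' j j' h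
  have hii : i = i' := by
    rcases le_total i i' with hle | hle
    · exact key i i' hle hi' _ (hB i j) (h ▸ hB i' j')
    · exact (key i' i hle hi _ (hB i' j') (h ▸ hB i j)).symm
  subst hii
  exact ⟨rfl, hinj i h⟩

/-- Normal subgroup with six-element orbits, doubly transitive on each of them: if the edges
between any two orbits form a matching, then every orbit induces a complete graph. -/
theorem adj_of_mem_orbit_of_matching [MulAction.IsPretransitive G V] (N : Subgroup G) [N.Normal]
    (hX : ∀ (g : G) (u v : V), X.Adj (g • u) (g • v) ↔ X.Adj u v) (hconn : X.Connected)
    (hblocks : ∀ v : V, (MulAction.orbit N v).ncard = 6)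
    (htwo : ∀ x : V, ∀ y ∈ MulAction.orbit N x, ∀ z ∈ MulAction.orbit N x, y ≠ x → z ≠ x →
      ∃ n : N, n • x = x ∧ n • y = z)
    (hmatch : ∀ u v w, X.Adj u v → X.Adj u w → v ∉ MulAction.orbit N u →
      w ∈ MulAction.orbit N v → w = v) (u v : V) (hv : v ∈ MulAction.orbit N u) (huv : v ≠ u) :
    X.Adj u v := by
  by_cases hedge : ∃ a b, X.Adj a b ∧ b ∈ MulAction.orbit N a
  · obtain ⟨a, b, hab, hb⟩ := hedge
    obtain ⟨g, rfl⟩ := MulAction.exists_smul_eq G a u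
    have hgb : g • b ∈ MulAction.orbit N (g • a) := by
      rw [← MulAction.smul_orbit_eq_orbit_smul]
      exact Set.smul_mem_smul_set hb
    obtain ⟨n, hn, rfl⟩ := htwo (g • a) (g • b) hgb v hv
      (fun h => hab.ne (smul_left_cancel g h).symm) huv
    have h1 : X.Adj (n • g • a) (n • g • b) := (hX n _ _).2 ((hX g _ _).2 hab)
    rwa [hn] at h1
  · exfalso
    push Not at hedge
    -- With no edges inside orbits, an element fixing u fixes each neighbour of u, the only one in
    -- its orbit, and so by connectedness every vertex; yet some such element moves v to z.
    obtain ⟨z, hz, hzu⟩ : ∃ z ∈ MulAction.orbit N u \ {u}, z ≠ v := by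
      refine Set.exists_ne_of_one_lt_ncard ?_ v
      rw [Set.ncard_sdiff_singleton_of_mem (MulAction.mem_orbit_self u), hblocks]
      norm_num
    obtain ⟨n, hnu, hnv⟩ := htwo u v hv z hz.1 huv hz.2
    have hfix : ∀ w, X.Reachable u w → n • w = w := by
      rintro w ⟨q⟩
      clear hnv hz hzu hv huv
      induction q with
      | nil => exact hnu
      | cons h q ih =>
        refine ih (hmatch _ _ _ h ?_ (hedge _ _ h) (MulAction.mem_orbit _ n))
        have h1 : X.Adj (n • _) (n • _) := (hX n _ _).2 h
        rwa [hnu] at h1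
    exact hzu (hnv.symm.trans (hfix v (hconn.preconnected u v)))

variable [Fintype V] [DecidableEq V]

/-- All consecutive pairs of blocks, the closing one included, are translates of (O, ρ • O), so one
dense pair suffices. -/
theorem exists_isHamiltonianCycle_of_dense_orbit
    (hX : ∀ (g : G) (u v : V), X.Adj (g • u) (g • v) ↔ X.Adj u v) (p : ℕ) (hp : 3 ≤ p)
    (hcard : Fintype.card V = 6 * p) (O : Set V) (hO6 : O.ncard = 6) (ρ : G)
    (hper : ∀ i : ℕ, ρ ^ i • O = O ↔ p ∣ i)
    (hO : ∀ i i' : ℕ, ∀ v, v ∈ ρ ^ i • O → v ∈ ρ ^ i' • O → ρ ^ i • O = ρ ^ i' • O)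
    (h1 : ∀ u ∈ O, ∀ v ∈ ρ • O, ∀ v' ∈ ρ • O, ¬ X.Adj u v → ¬ X.Adj u v' → v = v')
    (h2 : ∀ u ∈ O, ∀ u' ∈ O, ∀ v ∈ ρ • O, ¬ X.Adj u v → ¬ X.Adj u' v → u = u') :
    ∃ (a : V) (c : X.Walk a a), c.IsHamiltonianCycle := by
  have b : Fin 6 ≃ O := (Finite.equivFinOfCardEq (by rw [Nat.card_coe_set_eq, hO6])).symm
  -- With the second relation always true, this just yields a perfect matching from O to ρ • O.
  obtain ⟨τ, hτ⟩ := exists_perm_midpoint (fun j k => X.Adj (b j : V) (ρ • (b k : V)))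
    (fun _ _ => True)
    (fun j k k' h h' => b.injective (Subtype.ext (smul_left_cancel ρ
      (h1 _ (b j).2 _ (Set.smul_mem_smul_set (b k).2) _ (Set.smul_mem_smul_set (b k').2) h h'))))
    (fun j j' k h h' => b.injective (Subtype.ext
      (h2 _ (b j).2 _ (b j').2 _ (Set.smul_mem_smul_set (b k).2) h h')))
    (by simp) (by simp) 1
  obtain ⟨B, hB, hinj, -, hadj⟩ := exists_labelling_of_perm hX O ρ b τ fun j => (hτ j).1
  have h1' : ∀ i : ℕ, ∀ u ∈ ρ ^ i • O, ∀ v ∈ ρ ^ (i + 1) • O, ∀ v' ∈ ρ ^ (i + 1) • O,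
      ¬ X.Adj u v → ¬ X.Adj u v' → v = v' := by
    intro i
    rw [pow_succ, mul_smul]
    rintro _ ⟨u, hu, rfl⟩ _ ⟨v, hv, rfl⟩ _ ⟨v', hv', rfl⟩ h h'
    simp only [hX] at h h'
    rw [h1 u hu v hv v' hv' h h']
  have h2' : ∀ i : ℕ, ∀ u ∈ ρ ^ i • O, ∀ u' ∈ ρ ^ i • O, ∀ v ∈ ρ ^ (i + 1) • O,
      ¬ X.Adj u v → ¬ X.Adj u' v → u = u' := by
    intro i
    rw [pow_succ, mul_smul]
    rintro _ ⟨u, hu, rfl⟩ _ ⟨u', hu', rfl⟩ _ ⟨v, hv, rfl⟩ h h'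
    simp only [hX] at h h'
    rw [h2 u hu u' hu' v hv h h']
  have hp1 : ∀ j, B (p - 1) j ∈ ρ ^ (p - 2 + 1) • O := fun j => by
    rw [show p - 2 + 1 = p - 1 by omega]
    exact hB _ j
  -- Block 0 is also ρ ^ p • O, the successor of block p - 1.
  have hp0 : ∀ j, B 0 j ∈ ρ ^ (p - 1 + 1) • O := fun j => by
    rw [show p - 1 + 1 = p by omega, (hper p).2 dvd_rfl, ← (hper 0).2 (dvd_zero p)]
    exact hB 0 j
  exact exists_isHamiltonianCycle_of_dense_blocks p hp hcard B (labelling_injective hper hO hB hinj)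
    (fun i _ => hadj i)
    (fun j k k' h h' => hinj _ (h1' _ _ (hB _ j) _ (hp1 k) _ (hp1 k') h h'))
    (fun j j' k h h' => hinj _ (h2' _ _ (hB _ j) _ (hB _ j') _ (hp1 k) h h'))
    (fun j k k' h h' => hinj _ (h1' _ _ (hB _ j) _ (hp0 k) _ (hp0 k') h h'))
    (fun j j' k h h' => hinj _ (h2' _ _ (hB _ j) _ (hB _ j') _ (hp0 k) h h'))

/-- ρ ^ p preserves O but need not fix its points, so the closing matching is an arbitrary
permutation `s` of labels. -/
theorem exists_isHamiltonianCycle_of_complete_orbit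
    (hX : ∀ (g : G) (u v : V), X.Adj (g • u) (g • v) ↔ X.Adj u v) (p : ℕ) (hp : 3 ≤ p)
    (hcard : Fintype.card V = 6 * p) (O : Set V) (hO6 : O.ncard = 6) (ρ : G)
    (hper : ∀ i : ℕ, ρ ^ i • O = O ↔ p ∣ i)
    (hO : ∀ i i' : ℕ, ∀ v, v ∈ ρ ^ i • O → v ∈ ρ ^ i' • O → ρ ^ i • O = ρ ^ i' • O)
    (hcomp : ∀ u ∈ O, ∀ v ∈ O, u ≠ v → X.Adj u v)
    (hex : ∀ u ∈ O, ∃ v ∈ ρ • O, X.Adj u v)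
    (h2 : ∀ u ∈ O, ∀ u' ∈ O, ∀ v ∈ ρ • O, X.Adj u v → X.Adj u' v → u = u') :
    ∃ (a : V) (c : X.Walk a a), c.IsHamiltonianCycle := by
  have b : Fin 6 ≃ O := (Finite.equivFinOfCardEq (by rw [Nat.card_coe_set_eq, hO6])).symm
  have hf : ∀ j, ∃ k, X.Adj (b j : V) (ρ • (b k : V)) := by
    intro j
    obtain ⟨_, ⟨v, hv, rfl⟩, h⟩ := hex _ (b j).2
    exact ⟨b.symm ⟨v, hv⟩, by simpa using h⟩
  choose f hf using hf
  have hfi : Function.Injective f := fun j j' h => b.injective (Subtype.ext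
    (h2 _ (b j).2 _ (b j').2 _ (Set.smul_mem_smul_set (b (f j)).2) (hf j) (h ▸ hf j')))
  obtain ⟨B, hB, hinj, hsurj, hadj⟩ := exists_labelling_of_perm hX O ρ b
    (Equiv.ofBijective f (Finite.injective_iff_bijective.1 hfi)) hf
  have hs : ∀ j, ∃ k, B 0 k = B p j := fun j => hsurj 0 _ <| by
    have := hB p j
    rwa [(hper p).2 dvd_rfl, ← (hper 0).2 (dvd_zero p)] at this
  choose s hs using hs
  have hsi : Function.Injective s := fun j j' h => hinj p (by rw [← hs, ← hs, h])
  refine exists_isHamiltonianCycle_of_complete_blocks p hp hcard B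
    (labelling_injective hper hO hB hinj) ?_ (fun i _ => hadj i)
    (Equiv.ofBijective s (Finite.injective_iff_bijective.1 hsi)) ?_
  · intro i _ j j' hjj
    obtain ⟨u, hu, hu'⟩ := hB i j
    obtain ⟨v, hv, hv'⟩ := hB i j'
    rw [← hu', ← hv']
    refine (hX _ _ _).2 (hcomp u hu v hv ?_)
    rintro rfl
    exact hjj (hinj i (hu'.symm.trans hv'))
  · intro j
    rw [Equiv.ofBijective_apply, hs]
    have := hadj (p - 1) j
    rwa [show p - 1 + 1 = p by omega] at this

/-- Between two different orbits of size six of a group acting doubly transitively on its orbits,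
the edges form a matching or the complement of a matching. -/
theorem matching_or_compl_matching (N : Subgroup G)
    (hX : ∀ (g : G) (u v : V), X.Adj (g • u) (g • v) ↔ X.Adj u v)
    (hblocks : ∀ v : V, (MulAction.orbit N v).ncard = 6)
    (htwo : ∀ x : V, ∀ y ∈ MulAction.orbit N x, ∀ z ∈ MulAction.orbit N x, y ≠ x → z ≠ x →
      ∃ n : N, n • x = x ∧ n • y = z) (x y : V) :
    ((∀ a ∈ MulAction.orbit N x, ∀ b ∈ MulAction.orbit N y, ∀ b' ∈ MulAction.orbit N y,
        X.Adj a b → X.Adj a b' → b = b') ∧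
      ∀ a ∈ MulAction.orbit N x, ∀ a' ∈ MulAction.orbit N x, ∀ b ∈ MulAction.orbit N y,
        X.Adj a b → X.Adj a' b → a = a') ∨
    ((∀ a ∈ MulAction.orbit N x, ∀ b ∈ MulAction.orbit N y, ∀ b' ∈ MulAction.orbit N y,
        ¬ X.Adj a b → ¬ X.Adj a b' → b = b') ∧
      ∀ a ∈ MulAction.orbit N x, ∀ a' ∈ MulAction.orbit N x, ∀ b ∈ MulAction.orbit N y,
        ¬ X.Adj a b → ¬ X.Adj a' b → a = a') := by
  classical
  let S : Finset V := (MulAction.orbit N x).toFinset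
  let T : Finset V := (MulAction.orbit N y).toFinset
  have hS : S.card = 6 := by rw [← hblocks x, Set.ncard_eq_toFinset_card']
  have hT : T.card = 6 := by rw [← hblocks y, Set.ncard_eq_toFinset_card']
  have hmS : ∀ a, a ∈ S ↔ a ∈ MulAction.orbit N x := fun a => Set.mem_toFinset
  have hmT : ∀ a, a ∈ T ↔ a ∈ MulAction.orbit N y := fun a => Set.mem_toFinset
  have hXN : ∀ (n : N) (u v : V), X.Adj (n • u) (n • v) ↔ X.Adj u v := fun n => hX n
  have hinv : ∀ (n : N) (z v : V), n • v ∈ MulAction.orbit N z ↔ v ∈ MulAction.orbit N z :=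
    fun n z v => by
      rw [← MulAction.orbit_eq_iff, ← MulAction.orbit_eq_iff, MulAction.orbit_smul]
  obtain ⟨d, hd⟩ : ∃ d, ∀ a ∈ S, (T.filter fun b => X.Adj a b).card = d := by
    refine ⟨(T.filter fun b => X.Adj x b).card, fun a ha => ?_⟩
    obtain ⟨n, rfl⟩ := (hmS a).1 ha
    refine (Finset.card_bij (s := T.filter fun b => X.Adj x b) (fun b _ => n • b) ?_ ?_ ?_).symm
    · intro b hb
      simpa [hmT, hinv, hXN] using hb
    · exact fun b _ b' _ h => smul_left_cancel n h
    · intro b hb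
      refine ⟨n⁻¹ • b, ?_, smul_inv_smul n b⟩
      rw [Finset.mem_filter, hmT, hinv, ← hXN n, smul_inv_smul]
      simpa [hmT] using hb
  obtain ⟨d', hd'⟩ : ∃ d', ∀ b ∈ T, (S.filter fun a => X.Adj a b).card = d' := by
    refine ⟨(S.filter fun a => X.Adj a y).card, fun b hb => ?_⟩
    obtain ⟨n, rfl⟩ := (hmT b).1 hb
    refine (Finset.card_bij (s := S.filter fun a => X.Adj a y) (fun a _ => n • a) ?_ ?_ ?_).symm
    · intro b hb
      simpa [hmS, hinv, hXN] using hb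
    · exact fun b _ b' _ h => smul_left_cancel n h
    · intro b hb
      refine ⟨n⁻¹ • b, ?_, smul_inv_smul n b⟩
      rw [Finset.mem_filter, hmS, hinv, ← hXN n, smul_inv_smul]
      simpa [hmS] using hb
  have hxS : x ∈ S := (hmS x).2 (MulAction.mem_orbit_self x)
  -- The stabilizer of x is transitive on the rest of its orbit, so any y₀ gives the
  -- common-neighbour count.
  obtain ⟨y₀, hy₀, hy₀x⟩ := Finset.exists_mem_ne (by omega : 1 < S.card) x
  have hl : ∀ z ∈ S, z ≠ x → (T.filter fun b => X.Adj x b ∧ X.Adj z b).card =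
      (T.filter fun b => X.Adj x b ∧ X.Adj y₀ b).card := by
    intro z hz hzx
    obtain ⟨n, hnx, rfl⟩ := htwo x y₀ ((hmS _).1 hy₀) z ((hmS _).1 hz) hy₀x hzx
    have hXx : ∀ b, X.Adj x (n • b) ↔ X.Adj x b := fun b => by rw [← hXN n x b, hnx]
    refine (Finset.card_bij (fun b _ => n • b) ?_ ?_ ?_).symm
    · intro b hb
      simpa [hmT, hinv, hXN, hXx] using hb
    · exact fun b _ b' _ h => smul_left_cancel n h
    · intro b hb
      refine ⟨n⁻¹ • b, ?_, smul_inv_smul n b⟩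
      rw [Finset.mem_filter, hmT, hinv, ← hXx, ← hXN n y₀, smul_inv_smul]
      simpa [hmT] using hb
  obtain ⟨rfl, hdvd⟩ := valency_eq_and_dvd S T hS hT d d' _ hd hd' x hxS hl
  have hd6 : d ≤ 6 := by
    rw [← hd x hxS, ← hT]
    exact Finset.card_filter_le _ _
  have hcases : d ≤ 1 ∨ 5 ≤ d := by
    by_contra! h
    obtain ⟨h1, h2⟩ := h
    interval_cases d <;> omega
  rcases hcases with hd1 | hd5
  · left
    refine ⟨fun a ha b hb b' hb' h h' => ?_, fun a ha a' ha' b hb h h' => ?_⟩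
    · exact Finset.card_le_one.1 ((hd a ((hmS a).2 ha)).le.trans hd1) b (by simp [hmT, hb, h])
        b' (by simp [hmT, hb', h'])
    · exact Finset.card_le_one.1 ((hd' b ((hmT b).2 hb)).le.trans hd1) a (by simp [hmS, ha, h])
        a' (by simp [hmS, ha', h'])
  · right
    refine ⟨fun a ha b hb b' hb' h h' => ?_, fun a ha a' ha' b hb h h' => ?_⟩
    · have h3 := Finset.card_filter_add_card_filter_not (s := T) (fun b => X.Adj a b)
      rw [hd a ((hmS a).2 ha), hT] at h3
      exact Finset.card_le_one.1 (by omega : (T.filter fun b => ¬ X.Adj a b).card ≤ 1) b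
        (by simp [hmT, hb, h]) b' (by simp [hmT, hb', h'])
    · have h3 := Finset.card_filter_add_card_filter_not (s := S) (fun a => X.Adj a b)
      rw [hd' b ((hmT b).2 hb), hS] at h3
      exact Finset.card_le_one.1 (by omega : (S.filter fun a => ¬ X.Adj a b).card ≤ 1) a
        (by simp [hmS, ha, h]) a' (by simp [hmS, ha', h'])

/-- A connected graph on `6 * p` vertices with a transitive group of symmetries having a perfect
normal subgroup with orbits of size six has a Hamilton cycle. -/
theorem exists_isHamiltonianCycle_of_isPerfect [MulAction.IsPretransitive G V]
    (N : Subgroup G) [N.Normal] [Group.IsPerfect N]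
    (hX : ∀ (g : G) (u v : V), X.Adj (g • u) (g • v) ↔ X.Adj u v) (hconn : X.Connected)
    (p : ℕ) (hp : p.Prime) (hp3 : 3 ≤ p) (hcard : Fintype.card V = 6 * p)
    (hNt : ¬ MulAction.IsPretransitive N V)
    (hblocks : ∀ v : V, (MulAction.orbit N v).ncard = 6) :
    ∃ (a : V) (c : X.Walk a a), c.IsHamiltonianCycle := by
  have htwo : ∀ x : V, ∀ y ∈ MulAction.orbit N x, ∀ z ∈ MulAction.orbit N x, y ≠ x → z ≠ x →
      ∃ n : N, n • x = x ∧ n • y = z := by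
    intro x y hy z hz hyx hzx
    obtain ⟨n, h1, h2⟩ := Group.IsPerfect.exists_smul_eq_smul_eq (N := N)
      (α := MulAction.orbit N x) (by rw [Nat.card_coe_set_eq, hblocks])
      ⟨x, MulAction.mem_orbit_self x⟩ ⟨y, hy⟩ ⟨z, hz⟩ (fun h => hyx (congrArg Subtype.val h))
      (fun h => hzx (congrArg Subtype.val h))
    exact ⟨n, congrArg Subtype.val h1, congrArg Subtype.val h2⟩
  have hrot : ∀ x y : V, y ∉ MulAction.orbit N x → ∃ ρ : G,
      ρ • MulAction.orbit N x = MulAction.orbit N y ∧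
        ∀ i : ℕ, ρ ^ i • MulAction.orbit N x = MulAction.orbit N x ↔ p ∣ i := by
    intro x y hxy
    -- The N-orbits are blocks for G, and 6 times their number is 6 * p.
    have hc : Nat.card (MulAction.orbit G (MulAction.orbit N x : Set V)) = p := by
      have h1 := (MulAction.IsBlock.orbit_of_normal (G := G) (N := N) x).ncard_block_mul_ncard_orbit_eq
        ⟨x, MulAction.mem_orbit_self x⟩
      rw [hblocks, Nat.card_eq_fintype_card, hcard] at h1
      rw [Nat.card_coe_set_eq]
      omega
    have hy : (MulAction.orbit N y : Set V) ∈ MulAction.orbit G (MulAction.orbit N x : Set V) := by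
      obtain ⟨g, rfl⟩ := MulAction.exists_smul_eq G x y
      exact ⟨g, MulAction.smul_orbit_eq_orbit_smul N x g⟩
    have hfin : Finite (MulAction.orbit G (MulAction.orbit N x : Set V)) :=
      (Nat.card_pos_iff.1 (hc ▸ hp.pos)).2
    obtain ⟨ρ, h1, h2⟩ := MulAction.exists_smul_eq_and_pow_smul_eq_iff (G := G) p hp hc
      ⟨_, MulAction.mem_orbit_self _⟩ ⟨_, hy⟩ (fun h => hxy (by
        rw [show MulAction.orbit N x = MulAction.orbit N y from congrArg Subtype.val h]
        exact MulAction.mem_orbit_self y))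
    refine ⟨ρ, congrArg Subtype.val h1, fun i => ?_⟩
    rw [← h2 i, Subtype.ext_iff]
    rfl
  have hO : ∀ (x : V) (ρ : G) (i i' : ℕ), ∀ v, v ∈ ρ ^ i • MulAction.orbit N x →
      v ∈ ρ ^ i' • MulAction.orbit N x →
        ρ ^ i • MulAction.orbit N x = ρ ^ i' • MulAction.orbit N x := by
    intro x ρ i i' v h h'
    rw [MulAction.smul_orbit_eq_orbit_smul] at h h' ⊢
    rw [MulAction.smul_orbit_eq_orbit_smul, ← MulAction.orbit_eq_iff.2 h,
      ← MulAction.orbit_eq_iff.2 h']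
  by_cases hdense : ∃ x y, y ∉ MulAction.orbit N x ∧
      (∀ a ∈ MulAction.orbit N x, ∀ b ∈ MulAction.orbit N y, ∀ b' ∈ MulAction.orbit N y,
        ¬ X.Adj a b → ¬ X.Adj a b' → b = b') ∧
      ∀ a ∈ MulAction.orbit N x, ∀ a' ∈ MulAction.orbit N x, ∀ b ∈ MulAction.orbit N y,
        ¬ X.Adj a b → ¬ X.Adj a' b → a = a'
  · obtain ⟨x, y, hxy, h1, h2⟩ := hdense
    obtain ⟨ρ, hρ, hper⟩ := hrot x y hxy
    rw [← hρ] at h1 h2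
    exact exists_isHamiltonianCycle_of_dense_orbit hX p hp3 hcard _ (hblocks x) ρ hper (hO x ρ) h1 h2
  · have hm : ∀ x y, y ∉ MulAction.orbit N x → _ := fun x y hxy =>
      (matching_or_compl_matching N hX hblocks htwo x y).resolve_right
        fun h => hdense ⟨x, y, hxy, h⟩
    -- If every edge stayed within an orbit, connectedness would make N transitive.
    obtain ⟨x, y, hadj, hxy⟩ : ∃ x y, X.Adj x y ∧ y ∉ MulAction.orbit N x := by
      by_contra! h
      refine hNt ⟨fun u v => ?_⟩
      obtain ⟨q⟩ := hconn.preconnected u v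
      have : v ∈ MulAction.orbit N u := by
        induction q with
        | nil => exact MulAction.mem_orbit_self _
        | cons hadj q ih =>
          rw [← MulAction.orbit_eq_iff.2 (h _ _ hadj)]
          exact ih
      exact this
    obtain ⟨ρ, hρ, hper⟩ := hrot x y hxy
    refine exists_isHamiltonianCycle_of_complete_orbit hX p hp3 hcard _ (hblocks x) ρ hper (hO x ρ)
      ?_ ?_ ?_
    · intro u hu v hv huv
      refine adj_of_mem_orbit_of_matching N hX hconn hblocks htwo ?_ u v ?_ huv.symm
      · intro a b c hab hac hb hc
        exact (hm a b hb).1 a (MulAction.mem_orbit_self a) c hc b (MulAction.mem_orbit_self b)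
          hac hab
      · rwa [MulAction.orbit_eq_iff.2 hu]
    · rintro _ ⟨n, rfl⟩
      rw [hρ]
      exact ⟨n • y, MulAction.mem_orbit y n, (hX n x y).2 hadj⟩
    · rw [hρ]
      exact (hm x y hxy).2

end SimpleGraph

/-! ### The main theorem -/

theorem mainTheorem6 {V : Type*} [Fintype V] [DecidableEq V] (X : SimpleGraph V)
    (p : ℕ) (hp : p.Prime) (hp3 : 3 < p) (hcard : Fintype.card V = 6 * p)
    (hconn : X.Connected) (hX : X.IsGenuinelyImprimitive)
    (G : Subgroup (X ≃g X)) (hG : IsImprimitiveAction G V)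
    (N : Subgroup G) (hN : IsMinimalNormal N) (hNt : ¬ MulAction.IsPretransitive N V)
    (hblocks : ∀ v : V, (MulAction.orbit N v).ncard = 6) :
    ∃ (a : V) (c : X.Walk a a), c.IsHamiltonianCycle := by
  have := hG.1
  have := hN.1
  have : Finite (X ≃g X) := Finite.of_injective (fun e => (e : V → V)) DFunLike.coe_injective
  obtain ⟨v⟩ := hconn.nonempty
  have h6 : 6 ∣ Nat.card N := by
    rw [← hblocks v, ← MulAction.index_stabilizer]
    exact Subgroup.index_dvd_card _
  have := hN.isPerfect h6
  exact SimpleGraph.exists_isHamiltonianCycle_of_isPerfect N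
    (fun g u v => (g : X ≃g X).map_adj_iff) hconn p hp hp3.le hcard hNt hblocks
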